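/- A permutation is a finite (possibly empty) sequence $\pi=\pi_1\pi_2\cdots\pi_m$ of distinct positive integers; $|\pi|=m$ is its length and $\mathrm{dom}(\pi)$ its set of entries. Its descent set is $\mathrm{Des}(\pi)=\{i : 1\le i<m,\ \pi_i>\pi_{i+1}\}$ and its major index is $\mathrm{maj}(\pi)=\sum_{i\in\mathrm{Des}(\pi)} i$. For permutations $\pi,\sigma$ with disjoint domains, the shuffle set $\mathrm{Sh}(\pi,\sigma)$ is the set of all permutations of $\mathrm{dom}(\pi)\sqcup\mathrm{dom}(\sigma)$ in which both $\pi$ and $\sigma$ occur as subwords. A permutation statistic is a function $\mathrm{St}$ on permutations such that $\mathrm{St}(\pi)$ depends only on the relative order of the entries of $\pi$. It is shuffle compatible if, for all permutations $\pi,\pi',\sigma,\sigma'$ with $|\pi|=|\pi'|$, $|\sigma|=|\sigma'|$, $\mathrm{dom}(\pi)\cap\mathrm{dom}(\sigma)=\mathrm{dom}(\pi')\cap\mathrm{dom}(\sigma')=\emptyset$, $\mathrm{St}(\pi)=\mathrm{St}(\pi')$ and $\mathrm{St}(\sigma)=\mathrm{St}(\sigma')$, the multisets $\{\{\mathrm{St}(\tau):\tau\in\mathrm{Sh}(\pi,\sigma)\}\}$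 and $\{\{\mathrm{St}(\tau):\tau\in\mathrm{Sh}(\pi',\sigma')\}\}$ are equal. **Theorem.** (a) $\mathrm{maj}$ is a permutation statistic and is shuffle compatible. (b) Let $\sigma$ be a permutation and let $i\in\mathrm{Des}(\sigma)$ with $i-1\notin\mathrm{Des}(\sigma)$ (where $i=1$ is allowed). Put $D=(\mathrm{Des}(\sigma)\setminus\{i\})\cup\{i-1\}$ if $i\ge 2$ and $D=\mathrm{Des}(\sigma)\setminus\{1\}$ if $i=1$. Then there is a permutation $\sigma''$ with $\mathrm{dom}(\sigma'')=\mathrm{dom}(\sigma)$ and $\mathrm{Des}(\sigma'')=D$. Moreover, for every permutation $\pi$ and every permutation $\sigma''$ with $|\sigma''|=|\sigma|$ and $\mathrm{Des}(\sigma'')=D$ such that $\mathrm{dom}(\pi)$ is disjoint from $\mathrm{dom}(\sigma)$ and from $\mathrm{dom}(\sigma'')$, there is a bijection $\Phi:\mathrm{Sh}(\pi,\sigma)\to\mathrm{Sh}(\pi,\sigma'')$ with $\mathrm{maj}(\Phi(\tau))=\mathrm{maj}(\tau)-1$ for all $\tau\in\mathrm{Sh}(\pi,\sigma)$. (c) Let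 $\pi,\sigma$ be permutations with disjoint domains and let $\sigma_0$ be the increasing permutation of $\mathrm{dom}(\sigma)$. Then there is a bijection $\Phi:\mathrm{Sh}(\pi,\sigma)\to\mathrm{Sh}(\pi,\sigma_0)$ with $\mathrm{maj}(\Phi(\tau))=\mathrm{maj}(\tau)-\mathrm{maj}(\sigma)$ for all $\tau\in\mathrm{Sh}(\pi,\sigma)$. -/

import Mathlib

namespace ShufflePerm

/-- A permutation: a finite sequence of distinct positive integers. -/
abbrev Permutation : Type := {l : List ℕ+ // l.Nodup}

/-- The domain of `π`, i.e. its set of entries. -/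
def dom (π : Permutation) : Finset ℕ+ := π.1.toFinset

/-- The length `|π|`. -/
def len (π : Permutation) : ℕ := π.1.length

/-- `L U`: all linear orders on `U`, i.e. all permutations with domain `U`. -/
def L (U : Finset ℕ+) : Finset Permutation := Finset.subtype List.Nodup U.val.lists.toFinset

theorem mem_L {U : Finset ℕ+} {π : Permutation} : π ∈ L U ↔ dom π = U := by
  rw [L, Finset.mem_subtype, Multiset.mem_toFinset, Multiset.mem_lists_iff, ← Finset.val_inj, dom, List.toFinset_val,
    List.dedup_eq_self.mpr π.2]
  exact eq_comm

/-- The increasing permutation of `U`. -/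
def increasing (U : Finset ℕ+) : Permutation := ⟨U.sort (· ≤ ·), U.sort_nodup (· ≤ ·)⟩

/-- The descent set: positions `i` (counted from `1`) with `π_i > π_{i+1}`.  In the range
`1 ≤ i < |π|` both list positions `i - 1` and `i` (counted from `0`) exist, so that the default
value of `getD` plays no role. -/
def Des (π : Permutation) : Finset ℕ :=
  (Finset.Ico 1 (len π)).filter fun i => π.1.getD i 1 < π.1.getD (i - 1) 1

/-- The major index: the sum of the descents. -/
def maj (π : Permutation) : ℕ := ∑ i ∈ Des π, i

/-- Same relative order: `π'` arises from `π` by applying, entry by entry, a map that is strictly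
increasing on `dom π` (hence an increasing bijection from `dom π` onto `dom π'`). -/
def SameRelativeOrder (π π' : Permutation) : Prop :=
  ∃ f : ℕ+ → ℕ+, StrictMonoOn f (dom π : Set ℕ+) ∧ π'.1 = π.1.map f

/-- A permutation statistic depends only on the relative order of the entries. -/
def IsPermutationStatistic {α : Type*} (St : Permutation → α) : Prop :=
  ∀ π π' : Permutation, SameRelativeOrder π π' → St π = St π'

/-- The shuffle set of `π` and `σ` (used for `π` and `σ` with disjoint domains): the permutations
of `dom π ∪ dom σ` in which both `π` and `σ` occur as subwords. -/
def shuffles (π σ : Permutation) : Finset Permutation :=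
  (L (dom π ∪ dom σ)).filter fun τ => π.1.Sublist τ.1 ∧ σ.1.Sublist τ.1

/-- The distribution of `St` over a finite set of permutations, as a multiset. -/
def distribution {α : Type*} (St : Permutation → α) (P : Finset Permutation) : Multiset α :=
  P.val.map St

/-- Shuffle compatibility of a permutation statistic. -/
def ShuffleCompatible {α : Type*} (St : Permutation → α) : Prop :=
  IsPermutationStatistic St ∧
    ∀ π π' σ σ' : Permutation, len π = len π' → len σ = len σ' →
      Disjoint (dom π) (dom σ) → Disjoint (dom π') (dom σ') →
      St π = St π' → St σ = St σ' →
      distribution St (shuffles π σ) = distribution St (shuffles π' σ')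

/-- Move the element `i` of `D` one place to the left; at `i = 1` it disappears. -/
def shiftLeft (D : Finset ℕ) (i : ℕ) : Finset ℕ :=
  if i = 1 then D.erase 1 else insert (i - 1) (D.erase i)

end ShufflePerm

namespace ShufflePerm

open Polynomial

/-! For disjoint `π`, `σ` of lengths `m`, `n`, the generating function of `maj` over the shuffles is
`q^(maj π + maj σ)` times the Gaussian binomial `[m + n choose m]` (`sum_X_pow_maj_shuffles`). Only
lengths and major indices enter, which is shuffle compatibility. Lowering `maj σ` by `d` at fixed
length divides the polynomial by `q^d`, so equal fibre sizes give the bijections of (b), with `d =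
1`, and (c), with `d = maj σ`; neither is explicit.

The formula is proved by induction on last letters: appending a letter creates at most one descent,
at the old length. Words are reversed so that appending becomes `cons`. The induction needs the
refinement by which word supplies the last letter (`revMajGen_wordShuffles_map_cons`); its step is
one of the two q-Pascal recurrences. -/

/-! ### Gaussian binomial coefficients -/

/-- The Gaussian binomial coefficient `[m + n choose m]`. -/
noncomputable def gauss : ℕ → ℕ → ℤ[X]
  | 0, _ => 1
  | _ + 1, 0 => 1
  | m + 1, n + 1 => gauss m (n + 1) + X ^ (m + 1) * gauss (m + 1) n

theorem gauss_zero_left (n : ℕ) : gauss 0 n = 1 := by rw [gauss]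

theorem gauss_zero_right (m : ℕ) : gauss m 0 = 1 := by cases m <;> rw [gauss]

theorem gauss_succ (m n : ℕ) :
    gauss (m + 1) (n + 1) = gauss m (n + 1) + X ^ (m + 1) * gauss (m + 1) n := by
  rw [gauss]

/-- This is the difference of the two q-Pascal recurrences, so the second one, `gauss_succ'`,
follows from the defining one. -/
theorem one_sub_mul_gauss (m n : ℕ) :
    (1 - X ^ (n + 1)) * gauss m (n + 1) = (1 - X ^ (m + 1)) * gauss (m + 1) n := by
  induction m generalizing n with
  | zero =>
    induction n with
    | zero => simp [gauss_zero_left, gauss_zero_right]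
    | succ n ih =>
      rw [gauss_zero_left] at *
      rw [gauss_succ, gauss_zero_left]
      linear_combination X * ih
  | succ m ihm =>
    induction n with
    | zero =>
      have h := ihm 0
      rw [gauss_zero_right] at *
      rw [gauss_succ, gauss_zero_right]
      linear_combination h
    | succ n ihn =>
      rw [gauss_succ m (n + 1), gauss_succ (m + 1) n]
      linear_combination ihm (n + 1) + X ^ (m + 2) * ihn

theorem gauss_succ' (m n : ℕ) :
    gauss (m + 1) (n + 1) = X ^ (n + 1) * gauss m (n + 1) + gauss (m + 1) n := by
  rw [gauss_succ]
  linear_combination one_sub_mul_gauss m n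

theorem gauss_comm (m n : ℕ) : gauss m n = gauss n m := by
  induction m generalizing n with
  | zero => rw [gauss_zero_left, gauss_zero_right]
  | succ m ihm =>
    induction n with
    | zero => rw [gauss_zero_left, gauss_zero_right]
    | succ n ihn => rw [gauss_succ, gauss_succ', ihm, ihn, add_comm]

/-! ### Descents of reversed words -/

/-- The descent set of the reversal of a word. -/
def revDes : List ℕ+ → Finset ℕ
  | [] => ∅
  | [_] => ∅
  | a :: c :: l => if a < c then insert (l.length + 1) (revDes (c :: l)) else revDes (c :: l)

/-- The major index of the reversal of a word. -/
def revMaj (l : List ℕ+) : ℕ := ∑ i ∈ revDes l, i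

theorem revDes_cons_cons (a c : ℕ+) (l : List ℕ+) : revDes (a :: c :: l) =
    if a < c then insert (l.length + 1) (revDes (c :: l)) else revDes (c :: l) := rfl

theorem lt_length_of_mem_revDes {l : List ℕ+} {i : ℕ} (h : i ∈ revDes l) :
    1 ≤ i ∧ i < l.length := by
  induction l with
  | nil => simp [revDes] at h
  | cons a l ih =>
    cases l with
    | nil => simp [revDes] at h
    | cons c l =>
      rw [revDes_cons_cons] at h
      simp only [List.length_cons] at *
      split_ifs at h
      · rcases Finset.mem_insert.mp h with rfl | h
        · omega
        · have := ih h; omega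
      · have := ih h; omega

theorem revMaj_cons_cons (a c : ℕ+) (l : List ℕ+) :
    revMaj (a :: c :: l) = (if a < c then l.length + 1 else 0) + revMaj (c :: l) := by
  rw [revMaj, revMaj, revDes_cons_cons]
  split_ifs
  · rw [Finset.sum_insert]
    intro h
    simpa using (lt_length_of_mem_revDes h).2
  · rw [zero_add]

theorem revDes_map {f : ℕ+ → ℕ+} {l : List ℕ+} (hf : StrictMonoOn f {x | x ∈ l}) :
    revDes (l.map f) = revDes l := by
  induction l with
  | nil => rfl
  | cons a l ih =>
    cases l with
    | nil => rfl
    | cons c l =>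
      have h := ih (hf.mono fun x hx => List.mem_cons_of_mem _ hx)
      rw [List.map_cons] at h
      rw [List.map_cons, List.map_cons, revDes_cons_cons, revDes_cons_cons, h, List.length_map]
      simp only [hf.lt_iff_lt (a := a) (b := c) (by simp) (by simp)]

theorem mem_revDes {l : List ℕ+} {i : ℕ} : i ∈ revDes l ↔
    (1 ≤ i ∧ i < l.length) ∧ l.reverse.getD i 1 < l.reverse.getD (i - 1) 1 := by
  induction l with
  | nil => simp [revDes]
  | cons a l ih =>
    cases l with
    | nil => simp [revDes]; omega
    | cons c l =>
      have key : i ∈ revDes (a :: c :: l) ↔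
          (i = l.length + 1 ∧ a < c) ∨ i ∈ revDes (c :: l) := by
        rw [revDes_cons_cons]
        split_ifs with h <;> simp [h]
      rw [key]
      by_cases hi : i = l.length + 1
      · subst hi
        have h : l.length + 1 ∉ revDes (c :: l) := fun h => by
          simpa using (lt_length_of_mem_revDes h).2
        simp [h]
      -- Every other position lies within the reversal of `c :: l`, at whose end reversing puts `a`.
      · rw [ih]
        simp only [hi, false_and, false_or, List.length_cons]
        constructor
        · rintro ⟨⟨h1, h2⟩, h⟩
          refine ⟨⟨h1, by omega⟩, ?_⟩
          rw [List.reverse_cons (a := a), List.getD_append _ _ _ _ (by simp; omega),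
            List.getD_append _ _ _ _ (by simp; omega)]
          exact h
        · rintro ⟨⟨h1, h2⟩, h⟩
          refine ⟨⟨h1, by omega⟩, ?_⟩
          rw [List.reverse_cons (a := a), List.getD_append _ _ _ _ (by simp; omega),
            List.getD_append _ _ _ _ (by simp; omega)] at h
          exact h

theorem Des_eq_revDes (π : Permutation) : Des π = revDes π.1.reverse := by
  ext i
  rw [mem_revDes, Des, Finset.mem_filter, Finset.mem_Ico, List.reverse_reverse,
    List.length_reverse, len]

theorem maj_eq_revMaj (π : Permutation) : maj π = revMaj π.1.reverse := by
  rw [maj, revMaj, Des_eq_revDes]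

theorem isPermutationStatistic_maj : IsPermutationStatistic maj := by
  rintro π π' ⟨f, hf, h⟩
  rw [maj, maj, Des_eq_revDes, Des_eq_revDes, h, ← List.map_reverse, revDes_map]
  exact hf.mono fun x hx => by simpa [dom] using hx

/-- Every set of positions is the descent set of a permutation of `U`. -/
theorem exists_revDes_eq (U : Finset ℕ+) (D : Finset ℕ) :
    ∃ l : List ℕ+, l.Nodup ∧ l.toFinset = U ∧
      ∀ i, i ∈ revDes l ↔ i ∈ D ∧ 1 ≤ i ∧ i < U.card := by
  obtain ⟨n, hn⟩ : ∃ n, U.card = n := ⟨_, rfl⟩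
  induction n generalizing U with
  | zero =>
    rw [Finset.card_eq_zero] at hn
    exact ⟨[], List.nodup_nil, by simp [hn], by simp [revDes, hn]⟩
  | succ n ih =>
    have hU : U.Nonempty := Finset.card_pos.mp (by omega)
    -- The letter `a` is last in the permutation: the minimum of `U` forces a descent at `n`, the
    -- maximum prevents it, whatever letter precedes.
    obtain ⟨a, ha, hlt⟩ : ∃ a ∈ U, ∀ c ∈ U.erase a, a < c ↔ n ∈ D := by
      by_cases hD : n ∈ D
      · refine ⟨U.min' hU, U.min'_mem hU, fun c hc => ⟨fun _ => hD, fun _ => ?_⟩⟩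
        exact U.min'_lt_of_mem_erase_min' hU hc
      · refine ⟨U.max' hU, U.max'_mem hU, fun c hc => ⟨fun h => ?_, fun h => absurd h hD⟩⟩
        exact absurd h (U.lt_max'_of_mem_erase_max' hU hc).not_gt
    have hcard : (U.erase a).card = n := by rw [Finset.card_erase_of_mem ha, hn]; rfl
    obtain ⟨l, hl, hlU, hdes⟩ := ih (U.erase a) hcard
    have hlen : l.length = n := by rw [← hcard, ← hlU, List.toFinset_card_of_nodup hl]
    refine ⟨a :: l, ?_, ?_, fun i => ?_⟩
    · refine List.nodup_cons.mpr ⟨fun h => ?_, hl⟩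
      rw [← List.mem_toFinset, hlU] at h
      simp at h
    · rw [List.toFinset_cons, hlU, Finset.insert_erase ha]
    · rw [hn]
      cases l with
      | nil =>
        simp only [List.length_nil] at hlen
        simp only [revDes, Finset.notMem_empty, false_iff]
        omega
      | cons c l =>
        have hc := hlt c (by rw [← hlU]; simp)
        rw [hcard] at hdes
        rw [List.length_cons] at hlen
        rw [revDes_cons_cons, hlen]
        split_ifs with h
        · rw [Finset.mem_insert, hdes]
          have := hc.mp h
          constructor
          · rintro (rfl | h)
            · exact ⟨this, by omega, by omega⟩
            · exact ⟨h.1, by omega, by omega⟩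
          · rintro ⟨h1, h2, h3⟩
            by_cases hin : i = n
            · exact Or.inl hin
            · exact Or.inr ⟨h1, h2, by omega⟩
        · rw [hdes]
          have := mt hc.mpr h
          constructor
          · exact fun h => ⟨h.1, by omega, by omega⟩
          · rintro ⟨h1, h2, h3⟩
            have : i ≠ n := by rintro rfl; contradiction
            exact ⟨h1, h2, by omega⟩

/-! ### Shuffles of words -/

/-- The shuffles of two words, as a multiset. -/
def wordShuffles : List ℕ+ → List ℕ+ → Multiset (List ℕ+)
  | [], l => {l}
  | a :: k, [] => {a :: k}
  | a :: k, b :: l =>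
    (wordShuffles k (b :: l)).map (List.cons a) + (wordShuffles (a :: k) l).map (List.cons b)
termination_by k l => k.length + l.length

theorem wordShuffles_nil_left (l : List ℕ+) : wordShuffles [] l = {l} := by rw [wordShuffles]

theorem wordShuffles_nil_right (k : List ℕ+) : wordShuffles k [] = {k} := by
  cases k <;> rw [wordShuffles]

theorem wordShuffles_cons_cons (a b : ℕ+) (k l : List ℕ+) : wordShuffles (a :: k) (b :: l) =
    (wordShuffles k (b :: l)).map (List.cons a) +
      (wordShuffles (a :: k) l).map (List.cons b) := by
  rw [wordShuffles]

theorem wordShuffles_comm (k l : List ℕ+) : wordShuffles k l = wordShuffles l k := by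
  induction k generalizing l with
  | nil => rw [wordShuffles_nil_left, wordShuffles_nil_right]
  | cons a k ihk =>
    induction l with
    | nil => rw [wordShuffles_nil_left, wordShuffles_nil_right]
    | cons b l ihl =>
      rw [wordShuffles_cons_cons, wordShuffles_cons_cons, ihk, ihl, add_comm]

theorem perm_and_sublist_of_mem_wordShuffles {k l t : List ℕ+} (h : t ∈ wordShuffles k l) :
    t.Perm (k ++ l) ∧ k.Sublist t ∧ l.Sublist t := by
  induction k generalizing l t with
  | nil =>
    rw [wordShuffles_nil_left, Multiset.mem_singleton] at h
    simp [h]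
  | cons a k ihk =>
    induction l generalizing t with
    | nil =>
      rw [wordShuffles_nil_right, Multiset.mem_singleton] at h
      simp [h]
    | cons b l ihl =>
      rw [wordShuffles_cons_cons, Multiset.mem_add, Multiset.mem_map, Multiset.mem_map] at h
      rcases h with ⟨t, ht, rfl⟩ | ⟨t, ht, rfl⟩
      · obtain ⟨h1, h2, h3⟩ := ihk ht
        exact ⟨h1.cons a, h2.cons_cons a, h3.cons a⟩
      · obtain ⟨h1, h2, h3⟩ := ihl ht
        exact ⟨(h1.cons b).trans List.perm_middle.symm, h2.cons b, h3.cons_cons b⟩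

theorem mem_wordShuffles {k l t : List ℕ+} (hkl : (k ++ l).Nodup) :
    t ∈ wordShuffles k l ↔ t.Perm (k ++ l) ∧ k.Sublist t ∧ l.Sublist t := by
  refine ⟨perm_and_sublist_of_mem_wordShuffles, ?_⟩
  rintro ⟨hp, hk, hl⟩
  induction t generalizing k l with
  | nil => simp_all [wordShuffles_nil_left]
  | cons x t ih =>
    have hnd := hp.nodup_iff.mpr hkl
    have hxt : x ∉ t := (List.nodup_cons.mp hnd).1
    cases k with
    | nil =>
      rw [wordShuffles_nil_left, Multiset.mem_singleton]
      exact (hl.eq_of_length (by simpa using hp.length_eq.symm)).symm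
    | cons a k =>
      cases l with
      | nil =>
        rw [wordShuffles_nil_right, Multiset.mem_singleton]
        exact (hk.eq_of_length (by simpa using hp.length_eq.symm)).symm
      | cons b l =>
        rw [wordShuffles_cons_cons, Multiset.mem_add, Multiset.mem_map, Multiset.mem_map]
        have hab : a ≠ b := by
          rintro rfl
          simp at hkl
        by_cases hxa : x = a
        · subst hxa
          refine Or.inl ⟨t, ih (List.nodup_cons.mp hkl).2 ?_ ?_ ?_, rfl⟩
          · exact (List.perm_cons x).mp hp
          · exact List.cons_sublist_cons.mp hk
          · exact hl.of_cons_of_ne hab.symm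
        · have hk' := hk.of_cons_of_ne (Ne.symm hxa)
          -- If `x` were neither `a` nor `b`, both words would embed in `t`, and `x`, a letter of
          -- one of them, would occur in `t` again.
          have hxb : x = b := by
            by_contra hxb
            have hl' := hl.of_cons_of_ne (Ne.symm hxb)
            rcases List.mem_append.mp (hp.subset (List.mem_cons_self)) with h | h
            · exact hxt (hk'.subset h)
            · exact hxt (hl'.subset h)
          subst hxb
          have hp' := hp.trans List.perm_middle
          refine Or.inr ⟨t, ih ?_ ?_ hk' ?_, rfl⟩
          · exact (List.nodup_cons.mp (List.perm_middle.nodup_iff.mp hkl)).2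
          · exact (List.perm_cons x).mp hp'
          · exact List.cons_sublist_cons.mp hl

theorem nodup_wordShuffles {k l : List ℕ+} (hkl : k.Disjoint l) : (wordShuffles k l).Nodup := by
  induction k generalizing l with
  | nil => simp [wordShuffles_nil_left]
  | cons a k ihk =>
    induction l with
    | nil => simp [wordShuffles_nil_right]
    | cons b l ihl =>
      rw [wordShuffles_cons_cons, Multiset.nodup_add]
      refine ⟨(ihk (List.disjoint_of_disjoint_cons_left hkl)).map List.cons_injective,
        (ihl (List.disjoint_of_disjoint_cons_right hkl)).map List.cons_injective, ?_⟩
      rw [Multiset.disjoint_left]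
      intro t h1 h2
      obtain ⟨t1, -, rfl⟩ := Multiset.mem_map.mp h1
      obtain ⟨t2, -, h⟩ := Multiset.mem_map.mp h2
      have hba : b = a := (List.cons.inj h).1
      exact hkl (List.mem_cons_self) (hba ▸ List.mem_cons_self)

theorem map_reverse_shuffles {π σ : Permutation} (h : Disjoint (dom π) (dom σ)) :
    (shuffles π σ).val.map (fun τ => τ.1.reverse) =
      wordShuffles π.1.reverse σ.1.reverse := by
  have hd : π.1.reverse.Disjoint σ.1.reverse := by
    intro x hx hy
    exact Finset.disjoint_left.mp h (List.mem_toFinset.mpr (List.mem_reverse.mp hx))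
      (List.mem_toFinset.mpr (List.mem_reverse.mp hy))
  have hnd : (π.1.reverse ++ σ.1.reverse).Nodup :=
    (List.nodup_reverse.mpr π.2).append (List.nodup_reverse.mpr σ.2) hd
  refine (Multiset.Nodup.ext ?_ (nodup_wordShuffles hd)).mpr fun t => ?_
  · exact (shuffles π σ).nodup.map fun τ τ' h => Subtype.ext (List.reverse_injective h)
  · rw [mem_wordShuffles hnd, Multiset.mem_map]
    constructor
    · rintro ⟨τ, hτ, rfl⟩
      obtain ⟨h1, h2, h3⟩ := Finset.mem_filter.mp (Finset.mem_val.mp hτ)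
      rw [mem_L] at h1
      refine ⟨?_, List.reverse_sublist.mpr h2, List.reverse_sublist.mpr h3⟩
      refine List.perm_of_nodup_nodup_toFinset_eq (List.nodup_reverse.mpr τ.2) hnd ?_
      simpa [dom] using h1
    · rintro ⟨hp, hk, hl⟩
      refine ⟨⟨t.reverse, List.nodup_reverse.mpr (hp.nodup_iff.mpr hnd)⟩, ?_, by simp⟩
      rw [Finset.mem_val, shuffles, Finset.mem_filter, mem_L]
      refine ⟨?_, ?_, ?_⟩
      · simpa [dom] using List.toFinset_eq_of_perm _ _ hp
      · simpa using List.reverse_sublist.mpr hk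
      · simpa using List.reverse_sublist.mpr hl

/-! ### The generating function of the major index over shuffles -/

/-- The generating function of `revMaj` over a multiset of words. -/
noncomputable def revMajGen (s : Multiset (List ℕ+)) : ℤ[X] :=
  (s.map fun t => X ^ revMaj t).sum

theorem revMajGen_add (s t : Multiset (List ℕ+)) :
    revMajGen (s + t) = revMajGen s + revMajGen t := by
  simp [revMajGen]

theorem revMajGen_singleton (t : List ℕ+) : revMajGen {t} = X ^ revMaj t := by
  simp [revMajGen]

/-- Positions are counted from the far end of the word, so with a common length the junction of `a`
and `c` contributes the same factor to every term. -/
theorem revMajGen_map_cons_cons (a c : ℕ+) {s : Multiset (List ℕ+)} {n : ℕ}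
    (hs : ∀ t ∈ s, t.length = n) :
    revMajGen ((s.map (List.cons c)).map (List.cons a)) =
      (if a < c then X ^ (n + 1) else 1) * revMajGen (s.map (List.cons c)) := by
  simp only [revMajGen, Multiset.map_map, Function.comp_apply]
  rw [← Multiset.sum_map_mul_left]
  congr 1
  refine Multiset.map_congr rfl fun t ht => ?_
  rw [revMaj_cons_cons, hs t ht, pow_add]
  split_ifs <;> simp

theorem length_of_mem_wordShuffles {k l t : List ℕ+} (h : t ∈ wordShuffles k l) :
    t.length = k.length + l.length := by
  simpa using (perm_and_sublist_of_mem_wordShuffles h).1.length_eq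

/-- Fixing the leading letter `a` makes induction possible: the next letter is the head `c` of `k`
or else `b`, so the junction factor is constant on each of the two classes, and each class is again
of this form for shorter words. -/
theorem revMajGen_wordShuffles_map_cons (a b : ℕ+) (k l : List ℕ+)
    (h : (a :: k).Disjoint (b :: l)) :
    revMajGen ((wordShuffles k (b :: l)).map (List.cons a)) =
      X ^ (revMaj (a :: k) + revMaj (b :: l)) * (if a < b then X ^ (l.length + 1) else 1) *
        gauss k.length (l.length + 1) := by
  match k with
  | [] =>
    rw [wordShuffles_nil_left, Multiset.map_singleton, revMajGen_singleton, revMaj_cons_cons,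
      List.length_nil, gauss_zero_left, pow_add, pow_add]
    have : revMaj [a] = 0 := rfl
    rw [this]
    split_ifs <;> ring
  | c :: k =>
    have hbc : b ≠ c := by rintro rfl; simp at h
    have hab : a ≠ b := by rintro rfl; simp at h
    have hd := List.disjoint_of_disjoint_cons_left h
    rw [wordShuffles_cons_cons, Multiset.map_add, revMajGen_add,
      revMajGen_map_cons_cons a c fun t ht => length_of_mem_wordShuffles ht,
      revMajGen_map_cons_cons a b fun t ht => length_of_mem_wordShuffles ht,
      revMajGen_wordShuffles_map_cons c b k l hd, wordShuffles_comm,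
      revMajGen_wordShuffles_map_cons b c l k hd.symm, gauss_comm l.length, revMaj_cons_cons a c]
    simp only [List.length_cons]
    have h1 := gauss_succ k.length l.length
    have h2 := gauss_succ' k.length l.length
    -- Inconsistent comparisons of `a`, `b`, `c` are dismissed by `order`; every other case is a
    -- q-Pascal recurrence times a power of `X`.
    split_ifs <;>
      first
      | (exfalso; order)
      | (rw [h1]; ring1)
      | (rw [h2]; ring1)
termination_by k.length + l.length
decreasing_by all_goals (simp only [List.length_cons]; omega)

/-- Of the two classes by leading letter, the one led by the smaller letter carries the extra power
of `X`; this decides which recurrence adds them up. -/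
theorem revMajGen_wordShuffles {k l : List ℕ+} (h : k.Disjoint l) :
    revMajGen (wordShuffles k l) = X ^ (revMaj k + revMaj l) * gauss k.length l.length := by
  have h0 : revMaj [] = 0 := rfl
  cases k with
  | nil => rw [wordShuffles_nil_left, revMajGen_singleton, List.length_nil, gauss_zero_left, h0,
      zero_add, mul_one]
  | cons a k =>
    cases l with
    | nil => rw [wordShuffles_nil_right, revMajGen_singleton, List.length_nil, gauss_zero_right, h0,
        add_zero, mul_one]
    | cons b l =>
      have hab : a ≠ b := by rintro rfl; simp at h
      rw [wordShuffles_cons_cons, revMajGen_add, revMajGen_wordShuffles_map_cons a b k l h,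
        wordShuffles_comm, revMajGen_wordShuffles_map_cons b a l k h.symm, gauss_comm l.length]
      simp only [List.length_cons]
      split_ifs
      · order
      · rw [gauss_succ']; ring
      · rw [gauss_succ]; ring
      · order

/-- The generating function of `maj` over the shuffles of `π` and `σ`. -/
theorem sum_X_pow_maj_shuffles {π σ : Permutation} (h : Disjoint (dom π) (dom σ)) :
    ∑ τ ∈ shuffles π σ, (X : ℤ[X]) ^ maj τ = X ^ (maj π + maj σ) * gauss (len π) (len σ) := by
  have hd : π.1.reverse.Disjoint σ.1.reverse := by
    intro x hx hy
    exact Finset.disjoint_left.mp h (List.mem_toFinset.mpr (List.mem_reverse.mp hx))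
      (List.mem_toFinset.mpr (List.mem_reverse.mp hy))
  have := revMajGen_wordShuffles hd
  rw [← map_reverse_shuffles h, revMajGen, Multiset.map_map, List.length_reverse,
    List.length_reverse, ← maj_eq_revMaj, ← maj_eq_revMaj] at this
  rw [len, len, ← this]
  simp only [Function.comp_apply, maj_eq_revMaj]
  rfl

/-! ### From generating functions to multisets and bijections -/

theorem card_filter_eq_of_sum_X_pow_eq {α β : Type*} {s : Finset α} {t : Finset β} {f : α → ℕ}
    {g : β → ℕ} (h : ∑ x ∈ s, (X : ℤ[X]) ^ f x = ∑ y ∈ t, X ^ g y) (c : ℕ) :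
    (s.filter fun x => f x = c).card = (t.filter fun y => g y = c).card := by
  have := congrArg (fun p => coeff p c) h
  simp only [finsetSum_coeff, coeff_X_pow, @eq_comm _ c, Finset.sum_boole] at this
  exact_mod_cast this

theorem multiset_map_eq_of_sum_X_pow_eq {α β : Type*} {s : Finset α} {t : Finset β} {f : α → ℕ}
    {g : β → ℕ} (h : ∑ x ∈ s, (X : ℤ[X]) ^ f x = ∑ y ∈ t, X ^ g y) :
    s.val.map f = t.val.map g := by
  ext c
  rw [Multiset.count_map, Multiset.count_map]
  simp only [@eq_comm _ c]
  exact card_filter_eq_of_sum_X_pow_eq h c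

theorem exists_equiv_of_sum_X_pow_eq {α β : Type*} {s : Finset α} {t : Finset β} {f : α → ℕ}
    {g : β → ℕ} (h : ∑ x ∈ s, (X : ℤ[X]) ^ f x = ∑ y ∈ t, X ^ g y) :
    ∃ Φ : s ≃ t, ∀ x : s, g (Φ x).1 = f x.1 := by
  have e (c : ℕ) : Nonempty ({x : s // f x.1 = c} ≃ {y : t // g y.1 = c}) := by
    refine ⟨Fintype.equivOfCardEq ?_⟩
    rw [Fintype.card_subtype, Fintype.card_subtype, Finset.univ_eq_attach, Finset.univ_eq_attach,
      Finset.filter_attach (fun x => f x = c), Finset.filter_attach (fun y => g y = c)]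
    simpa using card_filter_eq_of_sum_X_pow_eq h c
  -- Arbitrary bijections between the fibres over each value are glued together.
  exact ⟨Equiv.ofFiberEquiv fun c => (e c).some,
    fun x => Equiv.ofFiberEquiv_map (f := fun x : s => f x.1) (g := fun y : t => g y.1) _ x⟩

theorem exists_equiv_shuffles {π σ σ' : Permutation} {d : ℕ} (h : Disjoint (dom π) (dom σ))
    (h' : Disjoint (dom π) (dom σ')) (hlen : len σ' = len σ) (hmaj : maj σ' + d = maj σ) :
    ∃ Φ : shuffles π σ ≃ shuffles π σ', ∀ τ : shuffles π σ, maj (Φ τ).1 + d = maj τ.1 := by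
  refine exists_equiv_of_sum_X_pow_eq (f := maj) (g := fun τ => maj τ + d) ?_
  simp only [pow_add _ _ d]
  rw [← Finset.sum_mul, sum_X_pow_maj_shuffles h, sum_X_pow_maj_shuffles h', hlen, ← hmaj]
  ring

theorem shuffleCompatible_maj : ShuffleCompatible maj := by
  refine ⟨isPermutationStatistic_maj, fun π π' σ σ' hπ hσ h h' hmπ hmσ => ?_⟩
  refine multiset_map_eq_of_sum_X_pow_eq ?_
  rw [sum_X_pow_maj_shuffles h, sum_X_pow_maj_shuffles h', hπ, hσ, hmπ, hmσ]

/-! ### Shifting a descent and the increasing permutation -/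

theorem len_eq_card_dom (π : Permutation) : len π = (dom π).card :=
  (List.toFinset_card_of_nodup π.2).symm

theorem exists_mem_L_Des_eq (U : Finset ℕ+) {D : Finset ℕ} (hD : ∀ i ∈ D, 1 ≤ i ∧ i < U.card) :
    ∃ π ∈ L U, Des π = D := by
  obtain ⟨l, hl, hU, hdes⟩ := exists_revDes_eq U D
  refine ⟨⟨l.reverse, List.nodup_reverse.mpr hl⟩, mem_L.mpr (by simpa [dom] using hU), ?_⟩
  ext i
  rw [Des_eq_revDes, List.reverse_reverse, hdes]
  exact and_iff_left_of_imp (hD i)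

/-- Since `i - 1` is not yet in `D`, the moved element is not absorbed; for `i = 1` erasing it
amounts to moving it to `0`. -/
theorem sum_shiftLeft {D : Finset ℕ} {i : ℕ} (hi : i ∈ D) (h1 : 1 ≤ i) (hi' : i - 1 ∉ D) :
    ∑ j ∈ shiftLeft D i, j + 1 = ∑ j ∈ D, j := by
  rw [shiftLeft]
  split_ifs with h
  · subst h
    exact Finset.sum_erase_add D id hi
  · rw [Finset.sum_insert fun h => hi' (Finset.mem_of_mem_erase h)]
    have := Finset.sum_erase_add D id hi
    simp only [id] at this
    omega

theorem dom_increasing (U : Finset ℕ+) : dom (increasing U) = U := by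
  simp [dom, increasing]

theorem maj_increasing (U : Finset ℕ+) : maj (increasing U) = 0 := by
  refine Finset.sum_eq_zero fun i hi => ?_
  obtain ⟨hi, hlt⟩ := Finset.mem_filter.mp hi
  obtain ⟨h1, h2⟩ := Finset.mem_Ico.mp hi
  rw [len] at h2
  rw [List.getD_eq_getElem _ _ h2, List.getD_eq_getElem _ _ (by omega)] at hlt
  have := (U.sortedLT_sort).strictMono_get (a := ⟨i - 1, by simp [increasing] at h2; simp; omega⟩)
    (b := ⟨i, by simpa [increasing] using h2⟩) (by simp; omega)
  exact absurd hlt (not_lt.mpr this.le)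

end ShufflePerm

open ShufflePerm in
theorem mainTheorem3 :
    ShuffleCompatible maj ∧
    (∀ (σ : Permutation) (i : ℕ), i ∈ Des σ → i - 1 ∉ Des σ →
      (∃ σ'' ∈ L (dom σ), Des σ'' = shiftLeft (Des σ) i) ∧
      ∀ π σ'' : Permutation, Disjoint (dom π) (dom σ) → Disjoint (dom π) (dom σ'') →
        len σ'' = len σ → Des σ'' = shiftLeft (Des σ) i →
        ∃ Φ : shuffles π σ ≃ shuffles π σ'',
          ∀ τ : shuffles π σ, maj (Φ τ).1 + 1 = maj τ.1) ∧
    (∀ π σ : Permutation, Disjoint (dom π) (dom σ) →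
      ∃ Φ : shuffles π σ ≃ shuffles π (increasing (dom σ)),
        ∀ τ : shuffles π σ, maj (Φ τ).1 + maj σ = maj τ.1) := by
  refine ⟨shuffleCompatible_maj, fun σ i hi hi' => ⟨?_, ?_⟩, fun π σ h => ?_⟩
  · have hσ (j : ℕ) (hj : j ∈ Des σ) : 1 ≤ j ∧ j < (dom σ).card := by
      rw [← len_eq_card_dom]
      exact Finset.mem_Ico.mp (Finset.mem_filter.mp hj).1
    refine exists_mem_L_Des_eq _ fun j hj => ?_
    rw [shiftLeft] at hj
    split_ifs at hj with h1
    · exact hσ j (Finset.mem_of_mem_erase hj)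
    · rcases Finset.mem_insert.mp hj with rfl | hj
      · have := hσ i hi
        omega
      · exact hσ j (Finset.mem_of_mem_erase hj)
  · intro π σ'' h h' hlen hdes
    refine exists_equiv_shuffles h h' hlen ?_
    rw [maj, hdes]
    exact sum_shiftLeft hi (Finset.mem_Ico.mp (Finset.mem_filter.mp hi).1).1 hi'
  · refine exists_equiv_shuffles h ?_ ?_ ?_
    · rwa [dom_increasing]
    · rw [len_eq_card_dom, len_eq_card_dom, dom_increasing]
    · rw [maj_increasing, zero_add]
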